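/- **Theorem (convex hull estimate).** Let $X$ be a real Banach space and let $\mathcal U$ be a free (that is, non-principal) ultrafilter on $\mathbb N$. Let $X^{\mathcal U}$ be the ultrapower of $X$: the quotient of $\ell_\infty(X)$, the space of bounded sequences in $X$ with the supremum norm, by the closed subspace of those $(x_n)_{n\in\mathbb N}$ with $\lim_{n,\mathcal U}\|x_n\|=0$, equipped with the quotient norm. For $K\subset X$ let $K^{\mathcal U}\subset X^{\mathcal U}$ be the set of the classes of the bounded sequences $(x_n)_{n\in\mathbb N}$ with $x_n\in K$ for all $n$. For a bounded subset $B$ of a real Banach space $E$ put $$\gamma(B)=\inf\{\varepsilon>0:\ \overline{B}^{w^*}\subset E+\varepsilon B_{E^{**}}\},$$ where $B$ and $E$ are regarded as subsets of the bidual $E^{**}$ through the natural embedding, $B_{E^{**}}$ is the closed unit ball of $E^{**}$, and the closure is taken in the weak$^*$ topology of $E^{**}$. Then for every bounded subset $A\subset X$, $$\gamma\big(\operatorname{conv}(A)^{\mathcal U}\big)\le 4\,\gamma\big(A^{\mathcal U}\big),$$ where $\operatorname{conv}(A)$ is the convex hull of $A$ and $\gamma$ is computed in $E=X^{\mathcal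 U}$. -/

import Mathlib

open Filter Topology
open scoped ENNReal Pointwise

noncomputable section

section Ultrapower

variable {X : Type*} [NormedAddCommGroup X] [NormedSpace ℝ X]

/-- The subspace of `ℓ_∞(X)` of the bounded sequences `(x_n)` with `lim_{n, U} ‖x_n‖ = 0`. -/
def ultraNull (X : Type*) [NormedAddCommGroup X] [NormedSpace ℝ X] (U : Ultrafilter ℕ) :
    Submodule ℝ (lp (fun _ : ℕ => X) ∞) where
  carrier := {x | Tendsto (fun n => ‖x n‖) (U : Filter ℕ) (𝓝 0)}
  zero_mem' := by simp
  add_mem' := by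
    intro x y hx hy
    have hx' := tendsto_zero_iff_norm_tendsto_zero.2 hx
    have hy' := tendsto_zero_iff_norm_tendsto_zero.2 hy
    have h := hx'.add hy'
    rw [add_zero] at h
    exact tendsto_zero_iff_norm_tendsto_zero.1 h
  smul_mem' := by
    intro c x hx
    have h := (tendsto_zero_iff_norm_tendsto_zero.2 hx).const_smul c
    rw [smul_zero] at h
    exact tendsto_zero_iff_norm_tendsto_zero.1 h

/-- The subspace is closed, so that the quotient is a normed space. -/
instance ultraNull_isClosed (U : Ultrafilter ℕ) :
    IsClosed (ultraNull X U : Set (lp (fun _ : ℕ => X) ∞)) := by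
  refine isClosed_of_closure_subset fun x hx => ?_
  change Tendsto (fun n => ‖x n‖) (U : Filter ℕ) (𝓝 0)
  rw [Metric.tendsto_nhds]
  intro ε hε
  obtain ⟨y, hy, hxy⟩ := Metric.mem_closure_iff.1 hx (ε / 2) (half_pos hε)
  have hy' : Tendsto (fun n => ‖y n‖) (U : Filter ℕ) (𝓝 0) := hy
  filter_upwards [Metric.tendsto_nhds.1 hy' (ε / 2) (half_pos hε)] with n hn
  have h1 : ‖x n - y n‖ ≤ ‖x - y‖ := by
    simpa using lp.norm_apply_le_norm ENNReal.top_ne_zero (x - y) n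
  rw [dist_eq_norm] at hxy
  simp only [dist_zero_right, norm_norm] at hn ⊢
  have h2 : ‖x n‖ ≤ ‖x n - y n‖ + ‖y n‖ := by
    simpa using norm_add_le (x n - y n) (y n)
  linarith

/-- The ultrapower `X^U`: the quotient of `ℓ_∞(X)` by `ultraNull X U`, with the quotient norm. -/
abbrev BanachUltrapower (X : Type*) [NormedAddCommGroup X] [NormedSpace ℝ X]
    (U : Ultrafilter ℕ) : Type _ :=
  lp (fun _ : ℕ => X) ∞ ⧸ ultraNull X U

/-- The set `K^U ⊆ X^U` of the classes of the bounded sequences all of whose terms lie in `K`. -/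
def ultrapowerSet (U : Ultrafilter ℕ) (K : Set X) : Set (BanachUltrapower X U) :=
  (ultraNull X U).mkQ '' {x | ∀ n, x n ∈ K}

end Ultrapower

/-- The measure of weak noncompactness `γ(A)`: the infimum of the `ε > 0` such that the
weak-star closure of `A` in the bidual is contained in `E + ε B_{E**}`. -/
def weakNoncompactness {E : Type*} [NormedAddCommGroup E] [NormedSpace ℝ E] (A : Set E) : ℝ :=
  sInf {ε : ℝ | 0 < ε ∧
    closure ((fun x => StrongDual.toWeakDual (NormedSpace.inclusionInDoubleDual ℝ E x)) '' A) ⊆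
      StrongDual.toWeakDual '' (Set.range (NormedSpace.inclusionInDoubleDual ℝ E) +
        ε • Metric.closedBall (0 : StrongDual ℝ (StrongDual ℝ E)) 1)}

end

open scoped BoundedContinuousFunction

noncomputable section

/-! Suppose a point of the weak-star closure of `conv(A)^U` has distance greater than `ε` from `E`.
A James-type construction (`exists_seq_separated`) gives `f i` in the dual ball and `x j` in
`conv(A)^U` with `f i (x j) > ε` for `i ≤ j` and `f i (x j) = 0` for `j < i`.

The task is to replace the `x j` by points of `A^U`. On the countably many `x j`, each `f i` comes
from a sequence of functionals on `X` (`exists_seq_tendsto_countable`), hence from a bounded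
function on `ℕ × A`. Each term of `x j` averages points of `A`, so `x j` yields a mean `e j` on such
functions. In `exists_convex_blocks`, convex combinations `g k` of these functions are made fast
Cauchy in the quadratic mean of one functional dominating all the `e j`. Separation in mean then
becomes separation at a point, and `exists_separated_of_convexHull` returns points of `A^U` and
functionals `G k`.

Finally, `le_four_mul_of_separated` exchanges limits twice. An element of `E + c B_{E**}` passes to
the weak-star limit of `G k` with error at most `2c`, so the separation is at most `4c`. -/

/-! ### Limits along an ultrafilter. -/

/-- Bounded real families converge along every ultrafilter. -/
theorem exists_tendsto_ultrafilter {ι : Type*} (U : Ultrafilter ι) {x : ι → ℝ} {C : ℝ}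
    (h : ∀ n, |x n| ≤ C) : ∃ l, Tendsto x (U : Filter ι) (𝓝 l) := by
  obtain ⟨l, -, hl⟩ := (isCompact_Icc (a := -C) (b := C)).ultrafilter_le_nhds (U.map x) (by
    rw [le_principal_iff]
    exact Filter.mem_map.2 (Filter.univ_mem' fun n => abs_le.1 (h n)))
  exact ⟨l, hl⟩

/-- The pointwise limit along an ultrafilter of a pointwise bounded family of linear
functionals. -/
theorem exists_linearMap_tendsto_ultrafilter {ι V : Type*} [AddCommGroup V] [Module ℝ V]
    (U : Ultrafilter ι) (m : ι → V →ₗ[ℝ] ℝ) (hm : ∀ v, ∃ C, ∀ n, |m n v| ≤ C) :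
    ∃ e : V →ₗ[ℝ] ℝ, ∀ v, Tendsto (fun n => m n v) (U : Filter ι) (𝓝 (e v)) := by
  have hex : ∀ v, ∃ l, Tendsto (fun n => m n v) (U : Filter ι) (𝓝 l) := fun v =>
    (hm v).elim fun _ hC => exists_tendsto_ultrafilter U hC
  choose e he using hex
  refine ⟨⟨⟨e, fun v w => ?_⟩, fun c v => ?_⟩, he⟩
  · refine tendsto_nhds_unique (he (v + w)) ?_
    simpa using (he v).add (he w)
  · refine tendsto_nhds_unique (he (c • v)) ?_
    simpa using (he v).const_mul c

/-- A bounded sequence, as an element of `ℓ_∞(X)`. -/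
def lpOfBounded {X : Type*} [NormedAddCommGroup X] (x : ℕ → X) {C : ℝ} (h : ∀ n, ‖x n‖ ≤ C) :
    lp (fun _ : ℕ => X) ∞ :=
  ⟨x, memℓp_infty ⟨C, by rintro _ ⟨n, rfl⟩; exact h n⟩⟩

@[simp] theorem lpOfBounded_apply {X : Type*} [NormedAddCommGroup X] (x : ℕ → X) {C : ℝ} (h : ∀ n, ‖x n‖ ≤ C)
    (n : ℕ) :
    lpOfBounded x h n = x n := rfl

/-! ### Functionals on the ultrapower. -/

section Ultrapower

variable {X : Type*} [NormedAddCommGroup X] [NormedSpace ℝ X]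

/-- A sequence of functionals in the unit ball of `X*` induces a functional on the ultrapower. -/
theorem exists_ultrapower_functional (U : Ultrafilter ℕ) (F : ℕ → StrongDual ℝ X)
    (hF : ∀ n, ‖F n‖ ≤ 1) :
    ∃ f : StrongDual ℝ (BanachUltrapower X U), ‖f‖ ≤ 1 ∧ ∀ x : lp (fun _ : ℕ => X) ∞,
      Tendsto (fun n => F n (x n)) (U : Filter ℕ) (𝓝 (f ((ultraNull X U).mkQ x))) := by
  have hb : ∀ (x : lp (fun _ : ℕ => X) ∞) (n : ℕ), |F n (x n)| ≤ ‖x n‖ := fun x n =>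
    ((F n).le_of_opNorm_le (hF n) (x n)).trans (one_mul _).le
  have hb' : ∀ (x : lp (fun _ : ℕ => X) ∞) (n : ℕ), |F n (x n)| ≤ ‖x‖ := fun x n =>
    (hb x n).trans (lp.norm_apply_le_norm ENNReal.top_ne_zero x n)
  obtain ⟨e, he⟩ := exists_linearMap_tendsto_ultrafilter U
    (fun n => ({ toFun := fun x => F n (x n)
                 map_add' := fun x y => by simp
                 map_smul' := fun c x => by simp } : lp (fun _ : ℕ => X) ∞ →ₗ[ℝ] ℝ))
    (fun x => ⟨‖x‖, hb' x⟩)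
  have hker : ultraNull X U ≤ LinearMap.ker e := by
    intro x hx
    refine LinearMap.mem_ker.2 (tendsto_nhds_unique (he x) ?_)
    exact squeeze_zero_norm (fun n => hb x n) hx
  have hnorm : ∀ x, ‖e x‖ ≤ ‖x‖ := fun x =>
    le_of_tendsto (he x).norm (Eventually.of_forall fun n => hb' x n)
  refine ⟨((ultraNull X U).liftQ e hker).mkContinuous 1 fun q => ?_,
    LinearMap.mkContinuous_norm_le _ zero_le_one _, fun x => he x⟩
  refine le_of_forall_pos_le_add fun δ hδ => ?_
  obtain ⟨x, rfl, hx⟩ := Submodule.Quotient.norm_mk_lt q hδ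
  rw [Submodule.liftQ_apply, one_mul]
  exact (hnorm x).trans hx.le

/-- The norm of a class is at most the limit of the norms of its terms. -/
theorem norm_mkQ_le_of_tendsto (U : Ultrafilter ℕ) (x : lp (fun _ : ℕ => X) ∞) {l : ℝ}
    (h : Tendsto (fun n => ‖x n‖) (U : Filter ℕ) (𝓝 l)) :
    ‖(ultraNull X U).mkQ x‖ ≤ l := by
  classical
  refine le_of_forall_pos_le_add fun δ hδ => ?_
  have hl : 0 ≤ l := ge_of_tendsto' h fun n => norm_nonneg _
  -- Terms of norm above `l + δ` occur only off a set of `U`, so cutting them to `0` does not change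
  -- the class.
  have hb : ∀ n, ‖if ‖x n‖ ≤ l + δ then x n else 0‖ ≤ l + δ := fun n => by
    split_ifs with hn
    · exact hn
    · simpa using by positivity
  have hev : ∀ᶠ n in (U : Filter ℕ), ‖x n‖ ≤ l + δ :=
    (h.eventually (gt_mem_nhds (lt_add_of_pos_right l hδ))).mono fun n hn => le_of_lt hn
  have hmk : (ultraNull X U).mkQ x = (ultraNull X U).mkQ (lpOfBounded _ hb) := by
    refine (Submodule.Quotient.eq _).2 ?_
    change Tendsto (fun n => ‖x n - _‖) (U : Filter ℕ) (𝓝 0)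
    refine tendsto_const_nhds.congr' ?_
    filter_upwards [hev] with n hn
    simp [hn]
  rw [hmk]
  exact (Submodule.Quotient.norm_mk_le _ _).trans
    (lp.norm_le_of_forall_le (by positivity) hb)

/-- On finitely many points, a functional in the unit ball of the dual of the ultrapower is
approximated by functionals induced by sequences in the unit ball of `X*`. -/
theorem exists_seq_approx_finite (U : Ultrafilter ℕ) {ι : Type*} [Fintype ι]
    (f : StrongDual ℝ (BanachUltrapower X U)) (hf : ‖f‖ ≤ 1)
    (x : ι → lp (fun _ : ℕ => X) ∞) {η : ℝ} (hη : 0 < η) :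
    ∃ F : ℕ → StrongDual ℝ X, (∀ n, ‖F n‖ ≤ 1) ∧
      ∀ j, ∀ᶠ n in (U : Filter ℕ), |F n (x j n) - f ((ultraNull X U).mkQ (x j))| < η := by
  classical
  let S : Set (ι → ℝ) := {v | ∃ F : ℕ → StrongDual ℝ X, (∀ n, ‖F n‖ ≤ 1) ∧
    ∀ j, Tendsto (fun n => F n (x j n)) (U : Filter ℕ) (𝓝 (v j))}
  have hS : Convex ℝ S := by
    rintro v ⟨F, hF, hFv⟩ w ⟨G, hG, hGw⟩ a b ha hb hab
    refine ⟨fun n => a • F n + b • G n, fun n => ?_, fun j => ?_⟩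
    · have := convex_closedBall (0 : StrongDual ℝ X) 1
        (mem_closedBall_zero_iff.2 (hF n)) (mem_closedBall_zero_iff.2 (hG n)) ha hb hab
      exact mem_closedBall_zero_iff.1 this
    · simpa using ((hFv j).const_mul a).add ((hGw j).const_mul b)
  have hmem : (fun j => f ((ultraNull X U).mkQ (x j))) ∈ closure S := by
    by_contra hcon
    obtain ⟨φ, u, hφ, hu⟩ := geometric_hahn_banach_closed_point hS.closure isClosed_closure hcon
    set c : ι → ℝ := fun j => φ (fun i => if j = i then 1 else 0) with hc
    have hφc : ∀ v, φ v = ∑ j, v j * c j := fun v =>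
      LinearMap.pi_apply_eq_sum_univ (φ : (ι → ℝ) →ₗ[ℝ] ℝ) v
    set z : lp (fun _ : ℕ => X) ∞ := ∑ j, c j • x j with hz
    -- Norming each `z n` gives `g` whose value at the class of `z` is `lim ‖z n‖`, at least the
    -- norm of that class; so `f` cannot exceed `g` there.
    choose F hF hFz using fun n => exists_dual_vector'' ℝ (z n)
    obtain ⟨g, hg, hgx⟩ := exists_ultrapower_functional U F hF
    have h1 := hφ (fun j => g ((ultraNull X U).mkQ (x j))) (subset_closure ⟨F, hF, fun j => hgx _⟩)
    have key : ∀ k : StrongDual ℝ (BanachUltrapower X U),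
        φ (fun j => k ((ultraNull X U).mkQ (x j))) = k ((ultraNull X U).mkQ z) := fun k => by
      rw [hφc, hz, map_sum, map_sum]
      refine Finset.sum_congr rfl fun j _ => ?_
      rw [map_smul, map_smul, smul_eq_mul, mul_comm]
    rw [key] at h1 hu
    have h2 : Tendsto (fun n => ‖z n‖) (U : Filter ℕ) (𝓝 (g ((ultraNull X U).mkQ z))) :=
      (hgx z).congr fun n => by simpa using hFz n
    have h3 := norm_mkQ_le_of_tendsto U z h2
    have h4 := (le_abs_self _).trans (f.le_of_opNorm_le hf ((ultraNull X U).mkQ z))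
    linarith
  obtain ⟨v, ⟨F, hF, hFv⟩, hv⟩ := Metric.mem_closure_iff.1 hmem η hη
  refine ⟨F, hF, fun j => ?_⟩
  have hj := (dist_le_pi_dist _ _ j).trans_lt hv
  rw [dist_comm] at hj
  have := (hFv j).dist (tendsto_const_nhds (x := f ((ultraNull X U).mkQ (x j))))
  exact this.eventually (gt_mem_nhds hj)

/-- On countably many points, a functional in the unit ball of the dual of the ultrapower agrees
with one induced by a sequence in the unit ball of `X*`. -/
theorem exists_seq_tendsto_countable (U : Ultrafilter ℕ) (hU : (U : Filter ℕ) ≤ cofinite)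
    (f : StrongDual ℝ (BanachUltrapower X U)) (hf : ‖f‖ ≤ 1)
    (x : ℕ → lp (fun _ : ℕ => X) ∞) :
    ∃ F : ℕ → StrongDual ℝ X, (∀ n, ‖F n‖ ≤ 1) ∧
      ∀ j, Tendsto (fun n => F n (x j n)) (U : Filter ℕ) (𝓝 (f ((ultraNull X U).mkQ (x j)))) := by
  classical
  let P : ℕ → ℕ → Prop := fun N k => ∃ G : StrongDual ℝ X, ‖G‖ ≤ 1 ∧
    ∀ j < k, |G (x j N) - f ((ultraNull X U).mkQ (x j))| < 1 / ((k : ℝ) + 1)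
  have hP0 : ∀ N, P N 0 := fun N => ⟨0, by simp, fun j hj => absurd hj (Nat.not_lt_zero j)⟩
  have hP : ∀ k, ∀ᶠ N in (U : Filter ℕ), P N k := fun k => by
    obtain ⟨F, hF, hFx⟩ := exists_seq_approx_finite U f hf (fun j : Fin k => x j)
      (Nat.one_div_pos_of_nat (α := ℝ) (n := k))
    filter_upwards [eventually_all.2 hFx] with N hN
    exact ⟨F N, hF N, fun j hj => hN ⟨j, hj⟩⟩
  -- Diagonal choice: index `N` uses the largest `k ≤ N` for which `P N k` holds. As `U` is free,
  -- the cap `N` eventually passes any fixed `k`.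
  have hK : ∀ N, P N (Nat.findGreatest (P N) N) := fun N =>
    Nat.findGreatest_spec (Nat.zero_le N) (hP0 N)
  choose F hF hFx using hK
  refine ⟨F, hF, fun j => Metric.tendsto_nhds.2 fun ε hε => ?_⟩
  obtain ⟨k, hk⟩ := exists_nat_one_div_lt hε
  have hlarge : ∀ᶠ N in (U : Filter ℕ), max k (j + 1) ≤ N :=
    (hU.trans Nat.cofinite_eq_atTop.le) (eventually_ge_atTop _)
  filter_upwards [hP (max k (j + 1)), hlarge] with N hN hN'
  have hle : max k (j + 1) ≤ Nat.findGreatest (P N) N := Nat.le_findGreatest hN' hN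
  refine (hFx N j (by omega)).trans (lt_of_le_of_lt ?_ hk)
  have : (k : ℝ) ≤ Nat.findGreatest (P N) N := by exact_mod_cast (le_max_left _ _).trans hle
  exact one_div_le_one_div_of_le (by positivity) (by linarith)

end Ultrapower

/-! ### Means and convex blocks. -/

/-- A point of the convex hull of `A` is the barycentre of a positive normalized functional on the
functions on `A`. -/
theorem exists_mean_of_mem_convexHull {X : Type*} [NormedAddCommGroup X] [NormedSpace ℝ X]
    {A : Set X} {x : X} (hx : x ∈ convexHull ℝ A) :
    ∃ m : (A → ℝ) →ₗ[ℝ] ℝ, (∀ w, 0 ≤ w → 0 ≤ m w) ∧ m 1 = 1 ∧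
      ∀ f : StrongDual ℝ X, m (fun a => f a) = f x := by
  refine convexHull_min (t := {x | ∃ m : (A → ℝ) →ₗ[ℝ] ℝ, (∀ w, 0 ≤ w → 0 ≤ m w) ∧ m 1 = 1 ∧
      ∀ f : StrongDual ℝ X, m (fun a => f a) = f x}) ?_ ?_ hx
  · exact fun a ha => ⟨LinearMap.proj ⟨a, ha⟩, fun w hw => hw _, rfl, fun f => rfl⟩
  · rintro x ⟨m, hm, hm1, hmx⟩ y ⟨n, hn, hn1, hny⟩ a b ha hb hab
    refine ⟨a • m + b • n, fun w hw => ?_, ?_, fun f => ?_⟩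
    · have := hm w hw
      have := hn w hw
      simp only [LinearMap.add_apply, LinearMap.smul_apply, smul_eq_mul]
      positivity
    · simp [hm1, hn1, hab]
    · simp [hmx, hny]

section Means

variable {Ω : Type*} [TopologicalSpace Ω]

theorem monotone_of_positive {e : (Ω →ᵇ ℝ) →ₗ[ℝ] ℝ} (he : ∀ w, 0 ≤ w → 0 ≤ e w)
    {u v : Ω →ᵇ ℝ} (h : u ≤ v) : e u ≤ e v := by
  have := he (v - u) (sub_nonneg.2 h)
  rw [map_sub] at this
  linarith

theorem abs_le_norm_of_mean {e : (Ω →ᵇ ℝ) →ₗ[ℝ] ℝ} (he : ∀ w, 0 ≤ w → 0 ≤ e w)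
    (he1 : e 1 = 1) (w : Ω →ᵇ ℝ) : |e w| ≤ ‖w‖ := by
  have h1 : w ≤ ‖w‖ • (1 : Ω →ᵇ ℝ) := fun p => by
    simpa using (le_abs_self _).trans (w.norm_coe_le_norm p)
  have h2 : -(‖w‖ • (1 : Ω →ᵇ ℝ)) ≤ w := fun p => by
    simpa using (abs_le.1 (w.norm_coe_le_norm p)).1
  have h1' := monotone_of_positive he h1
  have h2' := monotone_of_positive he h2
  rw [map_neg] at h2'
  rw [map_smul, he1, smul_eq_mul, mul_one] at h1' h2'
  exact abs_le.2 ⟨h2', h1'⟩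

/-- The Cauchy-Schwarz inequality for a mean, applied to `|w|` and `1`. -/
theorem mean_abs_le {e : (Ω →ᵇ ℝ) →ₗ[ℝ] ℝ} (he : ∀ w, 0 ≤ w → 0 ≤ e w)
    (he1 : e 1 = 1) {w : Ω →ᵇ ℝ} {t : ℝ} (ht : 0 < t) (h : e (w * w) ≤ t ^ 2) :
    e |w| ≤ t := by
  have h1 : 0 ≤ e (w * w - (2 * t) • |w| + (t ^ 2) • (1 : Ω →ᵇ ℝ)) := he _ fun p => by
    have : w p * w p - 2 * t * |w p| + t ^ 2 = (|w p| - t) ^ 2 := by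
      rw [sub_sq, sq_abs]; ring
    simpa [this] using sq_nonneg (|w p| - t)
  rw [map_add, map_sub, map_smul, map_smul, he1, smul_eq_mul, smul_eq_mul] at h1
  nlinarith

/-- Near-minimal elements of a decreasing sequence of bounded convex sets form a fast Cauchy
sequence for the quadratic form `w ↦ P (w * w)`. -/
theorem exists_seq_quadratic_cauchy {P : (Ω →ᵇ ℝ) →ₗ[ℝ] ℝ} (hP : ∀ w, 0 ≤ w → 0 ≤ P w)
    {C : ℕ → Set (Ω →ᵇ ℝ)} (hC : Antitone C) (hconv : ∀ k, Convex ℝ (C k))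
    (hne : ∀ k, (C k).Nonempty) {R : ℝ} (hR : ∀ u ∈ C 0, ‖u‖ ≤ R)
    {η : ℕ → ℝ} (hη : ∀ k, 0 < η k) (hη' : Antitone η) :
    ∃ g : ℕ → Ω →ᵇ ℝ, (∀ k, g k ∈ C k) ∧
      ∀ k, P ((g k - g (k + 1)) * (g k - g (k + 1))) ≤ η k := by
  set Q : (Ω →ᵇ ℝ) → ℝ := fun w => P (w * w) with hQ
  have hQ0 : ∀ w, 0 ≤ Q w := fun w => hP _ fun p => mul_self_nonneg _
  have hQR : ∀ k, ∀ u ∈ C k, Q u ≤ P ((R ^ 2) • (1 : Ω →ᵇ ℝ)) := fun k u hu => by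
    refine monotone_of_positive hP fun p => ?_
    have h1 : |u p| ≤ R := (u.norm_coe_le_norm p).trans (hR u (hC (Nat.zero_le k) hu))
    have h2 : |u p| ^ 2 ≤ R ^ 2 := pow_le_pow_left₀ (abs_nonneg _) h1 2
    rw [sq_abs] at h2
    simpa [← sq] using h2
  have hpar : ∀ u v, Q (u - v) = 2 * Q u + 2 * Q v - 4 * Q ((1 / 2 : ℝ) • u + (1 / 2 : ℝ) • v) := by
    intro u v
    have : (u - v) * (u - v) = (2 : ℝ) • (u * u) + (2 : ℝ) • (v * v) - (4 : ℝ) •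
        (((1 / 2 : ℝ) • u + (1 / 2 : ℝ) • v) * ((1 / 2 : ℝ) • u + (1 / 2 : ℝ) • v)) := by
      ext p
      simp
      ring
    simp only [hQ]
    rw [this, map_sub, map_add, map_smul, map_smul, map_smul]
    rfl
  set d : ℕ → ℝ := fun k => sInf (Q '' C k) with hd
  have hbdd : ∀ k, BddBelow (Q '' C k) := fun k => ⟨0, by rintro _ ⟨w, -, rfl⟩; exact hQ0 w⟩
  have hmono : Monotone d := fun k l hkl =>
    csInf_le_csInf (hbdd k) ((hne l).image Q) (Set.image_mono (hC hkl))
  have hdb : BddAbove (Set.range d) := by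
    refine ⟨P ((R ^ 2) • (1 : Ω →ᵇ ℝ)), ?_⟩
    rintro _ ⟨k, rfl⟩
    obtain ⟨u, hu⟩ := hne k
    exact (csInf_le (hbdd k) ⟨u, hu, rfl⟩).trans (hQR k u hu)
  have hlim := tendsto_atTop_ciSup hmono hdb
  set D := ⨆ k, d k with hD
  have hdD : ∀ k, d k ≤ D := fun k => le_ciSup hdb k
  have hN : ∀ k, ∃ N, ∀ n ≥ N, D - η k / 8 < d n := fun k =>
    eventually_atTop.1 (hlim.eventually (lt_mem_nhds (by linarith [hη k])))
  choose N hN using hN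
  -- The partial sums make `n` monotone while keeping `k ≤ n k` and `N k ≤ n k`.
  set n : ℕ → ℕ := fun k => k + ∑ i ∈ Finset.range (k + 1), N i with hn
  have hnk : ∀ k, k ≤ n k := fun k => Nat.le_add_right _ _
  have hnN : ∀ k, N k ≤ n k := fun k =>
    (Finset.single_le_sum (f := N) (fun _ _ => Nat.zero_le _)
      (Finset.self_mem_range_succ k)).trans (Nat.le_add_left _ _)
  have hnm : ∀ k, n k ≤ n (k + 1) := fun k => by
    simp only [hn]
    rw [Finset.sum_range_succ _ (k + 1)]
    omega
  have hg : ∀ k, ∃ g ∈ C (n k), Q g < D + η k / 8 := fun k => by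
    obtain ⟨_, ⟨g, hg, rfl⟩, h⟩ := exists_lt_of_csInf_lt ((hne (n k)).image Q)
      ((hdD (n k)).trans_lt (by linarith [hη k]) : sInf (Q '' C (n k)) < D + η k / 8)
    exact ⟨g, hg, h⟩
  choose g hgC hgQ using hg
  refine ⟨g, fun k => hC (hnk k) (hgC k), fun k => ?_⟩
  have h1 := hgQ k
  have h2 := hgQ (k + 1)
  have h3 := hη' (Nat.le_succ k)
  -- The midpoint stays in `C (n k)`, so its form exceeds `D - η k / 8`; the parallelogram law then
  -- bounds the difference by `(2 + 2 + 4) * η k / 8`.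
  have h4 : d (n k) ≤ Q ((1 / 2 : ℝ) • g k + (1 / 2 : ℝ) • g (k + 1)) :=
    csInf_le (hbdd _) ⟨_, hconv (n k) (hgC k) (hC (hnm k) (hgC (k + 1)))
      (by norm_num) (by norm_num) (by norm_num), rfl⟩
  have h5 := hN k (n k) (hnN k)
  have h6 := hpar (g k) (g (k + 1))
  change Q (g k - g (k + 1)) ≤ η k
  simp only [Nat.succ_eq_add_one] at h3
  linarith

/-- A positive functional which dominates a multiple of every member of a sequence of means, as
well as the limit of the sequence along an ultrafilter. -/
theorem exists_dominating_functional (U : Ultrafilter ℕ) {e : ℕ → (Ω →ᵇ ℝ) →ₗ[ℝ] ℝ}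
    (he : ∀ j w, 0 ≤ w → 0 ≤ e j w) (he1 : ∀ j, e j 1 = 1) :
    ∃ P : (Ω →ᵇ ℝ) →ₗ[ℝ] ℝ, (∀ w, 0 ≤ w → 0 ≤ P w) ∧
      (∀ w, 0 ≤ w → ∀ j, e j w ≤ 2 ^ j * P w) ∧
      ∀ w, 0 ≤ w → ∀ t, P w < t → ∀ᶠ j in (U : Filter ℕ), e j w < t := by
  have hbd : ∀ w j, |e j w| ≤ ‖w‖ := fun w j => abs_le_norm_of_mean (he j) (he1 j) w
  obtain ⟨e', he'⟩ := exists_linearMap_tendsto_ultrafilter U e fun w => ⟨‖w‖, hbd w⟩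
  have hsum : ∀ w, Summable fun j => (1 / 2 : ℝ) ^ j * e j w := fun w =>
    Summable.of_norm_bounded (summable_geometric_two.mul_right ‖w‖) fun j => by
      rw [norm_mul, norm_pow, Real.norm_eq_abs, Real.norm_eq_abs, abs_of_pos (by norm_num)]
      gcongr
      exact hbd w j
  let T : (Ω →ᵇ ℝ) →ₗ[ℝ] ℝ :=
    { toFun := fun w => ∑' j, (1 / 2 : ℝ) ^ j * e j w
      map_add' := fun v w => by
        rw [← (hsum v).tsum_add (hsum w)]
        simp only [map_add, mul_add]
      map_smul' := fun c w => by
        rw [RingHom.id_apply, smul_eq_mul, ← tsum_mul_left]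
        simp only [map_smul, smul_eq_mul, mul_left_comm] }
  have hT : ∀ w, T w = ∑' j, (1 / 2 : ℝ) ^ j * e j w := fun w => rfl
  have hpos : ∀ w, 0 ≤ w → ∀ j, 0 ≤ (1 / 2 : ℝ) ^ j * e j w := fun w hw j =>
    mul_nonneg (by positivity) (he j w hw)
  have hT0 : ∀ w, 0 ≤ w → 0 ≤ T w := fun w hw => tsum_nonneg (hpos w hw)
  have he0 : ∀ w, 0 ≤ w → 0 ≤ e' w := fun w hw => ge_of_tendsto' (he' w) fun j => he j w hw
  -- The weighted sum `T` gives the bounds with `2 ^ j`; the limit `e'` gives the eventual bounds.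
  refine ⟨e' + T, fun w hw => add_nonneg (he0 w hw) (hT0 w hw), fun w hw j => ?_,
    fun w hw t ht => ?_⟩
  · have h1 : (1 / 2 : ℝ) ^ j * e j w ≤ T w := (hsum w).le_tsum j fun i _ => hpos w hw i
    have h2 : e j w = 2 ^ j * ((1 / 2 : ℝ) ^ j * e j w) := by
      rw [← mul_assoc, ← mul_pow]; norm_num
    rw [h2]
    have := he0 w hw
    gcongr
    rw [LinearMap.add_apply]
    linarith
  · refine (he' w).eventually (gt_mem_nhds (lt_of_le_of_lt ?_ ht))
    rw [LinearMap.add_apply]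
    linarith [hT0 w hw]

theorem sum_half_pow_le (s : Finset ℕ) : ∑ k ∈ s, (1 / 2 : ℝ) ^ k ≤ 2 :=
  (summable_geometric_two.sum_le_tsum s fun _ _ => by positivity).trans tsum_geometric_two.le

/-- If means `e j` separate the functions `h i`, `i ≤ j`, from the functions `h i`, `i > j`, then
convex combinations of the `h i` are separated pointwise, on sets where the means are close to
being concentrated. -/
theorem exists_convex_blocks (U : Ultrafilter ℕ) (hU : (U : Filter ℕ) ≤ cofinite)
    {e : ℕ → (Ω →ᵇ ℝ) →ₗ[ℝ] ℝ}
    (he : ∀ j w, 0 ≤ w → 0 ≤ e j w) (he1 : ∀ j, e j 1 = 1)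
    {h : ℕ → Ω →ᵇ ℝ} {R : ℝ} (hR : ∀ i, ‖h i‖ ≤ R) {ε δ : ℝ}
    (hle : ∀ i j, i ≤ j → ε ≤ e j (h i)) (hlt : ∀ i j, j < i → e j (h i) ≤ 0) (hδ : 0 < δ) :
    ∃ g : ℕ → Ω →ᵇ ℝ, (∀ k, g k ∈ convexHull ℝ (Set.range h)) ∧
      ∀ m, ∃ j, ∀ M, ∃ ψ, ε - δ ≤ e j ψ ∧
        ∀ p, ∀ i ≤ m, ∀ k, j < k → k ≤ M → ψ p ≤ g i p - g k p := by
  obtain ⟨P, hP, hPe, hPU⟩ := exists_dominating_functional U he he1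
  set θ : ℝ := δ / 8 with hθ
  have hθ0 : 0 < θ := by positivity
  set C : ℕ → Set (Ω →ᵇ ℝ) := fun k => convexHull ℝ (h '' Set.Ici k) with hC
  obtain ⟨g, hgC, hgP⟩ := exists_seq_quadratic_cauchy hP (C := C)
    (fun k l hkl => convexHull_mono (Set.image_mono (Set.Ici_subset_Ici.2 hkl)))
    (fun k => convex_convexHull ℝ _)
    (fun k => ⟨h k, subset_convexHull ℝ _ ⟨k, Set.self_mem_Ici, rfl⟩⟩) (R := R)
    (fun u hu => by
      have : C 0 ⊆ Metric.closedBall 0 R := convexHull_min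
        (by rintro _ ⟨i, -, rfl⟩; exact mem_closedBall_zero_iff.2 (hR i)) (convex_closedBall _ _)
      exact mem_closedBall_zero_iff.1 (this hu))
    -- One factor `(1 / 2) ^ k`, once squared, absorbs the constant `2 ^ j` for `j < k`; the other
    -- keeps the errors summable.
    (η := fun k => (θ * (1 / 2) ^ k * (1 / 2) ^ k) ^ 2) (fun k => by positivity)
    (fun k l hkl => by
      have : (1 / 2 : ℝ) ^ l ≤ (1 / 2) ^ k :=
        pow_le_pow_of_le_one (by norm_num) (by norm_num) hkl
      dsimp only
      gcongr)
  refine ⟨g, fun k => convexHull_mono (Set.image_subset_range _ _) (hgC k), fun m => ?_⟩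
  set Δ : ℕ → Ω →ᵇ ℝ := fun k => g k - g (k + 1) with hΔ
  have hΔ0 : ∀ k, 0 ≤ Δ k * Δ k := fun k p => mul_self_nonneg _
  have hgm : ∃ n, ∀ j ≥ n, ε ≤ e j (g m) := by
    refine convexHull_min (t := {u | ∃ n, ∀ j ≥ n, ε ≤ e j u}) ?_ ?_ (hgC m)
    · rintro _ ⟨i, -, rfl⟩
      exact ⟨i, fun j hj => hle i j hj⟩
    · rintro u ⟨n, hn⟩ v ⟨n', hn'⟩ a b ha hb hab
      refine ⟨max n n', fun j hj => ?_⟩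
      have h1 := mul_le_mul_of_nonneg_left (hn j (le_of_max_le_left hj)) ha
      have h2 := mul_le_mul_of_nonneg_left (hn' j (le_of_max_le_right hj)) hb
      rw [map_add, map_smul, map_smul, smul_eq_mul, smul_eq_mul]
      calc ε = a * ε + b * ε := by rw [← add_mul, hab, one_mul]
        _ ≤ _ := add_le_add h1 h2
  obtain ⟨n, hn⟩ := hgm
  have hsmall : ∀ k, ∀ᶠ j in (U : Filter ℕ),
      e j (Δ k * Δ k) < (2 * (θ * (1 / 2) ^ k * (1 / 2) ^ k)) ^ 2 := fun k => by
    refine hPU _ (hΔ0 k) _ ((hgP k).trans_lt ?_)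
    have : 0 < θ * (1 / 2) ^ k * (1 / 2) ^ k := by positivity
    nlinarith
  have hev : ∀ᶠ j in (U : Filter ℕ), n ≤ j ∧ ∀ k ∈ Finset.range m,
      e j (Δ k * Δ k) < (2 * (θ * (1 / 2) ^ k * (1 / 2) ^ k)) ^ 2 :=
    Eventually.and ((hU.trans Nat.cofinite_eq_atTop.le) (eventually_ge_atTop n))
      ((Finset.eventually_all _).2 fun k _ => hsmall k)
  obtain ⟨j, hnj, hj⟩ := hev.exists
  have hgj : e j (g (j + 1)) ≤ 0 := by
    refine convexHull_min (t := {u | e j u ≤ 0}) ?_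
      (convex_halfSpace_le (e j).isLinear 0) (hgC (j + 1))
    rintro _ ⟨i, hi, rfl⟩
    exact hlt i j hi
  have hleft : ∀ k < m, e j |Δ k| ≤ 2 * θ * (1 / 2) ^ k := fun k hk => by
    refine (mean_abs_le (he j) (he1 j) (by positivity) (hj k (Finset.mem_range.2 hk)).le).trans ?_
    have : (1 / 2 : ℝ) ^ k ≤ 1 := pow_le_one₀ (by norm_num) (by norm_num)
    have : θ * (1 / 2) ^ k * (1 / 2) ^ k ≤ θ * (1 / 2) ^ k * 1 := by gcongr
    linarith
  have hright : ∀ k, j < k → e j |Δ k| ≤ 2 * θ * (1 / 2) ^ k := fun k hk => by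
    refine (mean_abs_le (he j) (he1 j) (t := θ * (1 / 2) ^ k) (by positivity) ?_).trans ?_
    · refine ((hPe _ (hΔ0 k) j).trans
        (mul_le_mul_of_nonneg_left (hgP k) (by positivity))).trans ?_
      have h1 : (2 : ℝ) ^ j * ((1 / 2) ^ k) ^ 2 ≤ 1 := by
        have h2 : (2 : ℝ) ^ j ≤ 2 ^ k := pow_le_pow_right₀ (by norm_num) hk.le
        have h3 : (1 / 2 : ℝ) ^ k ≤ 1 := pow_le_one₀ (by norm_num) (by norm_num)
        calc (2 : ℝ) ^ j * ((1 / 2) ^ k) ^ 2 ≤ 2 ^ k * ((1 / 2) ^ k) ^ 2 := by gcongr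
          _ = (2 * (1 / 2)) ^ k * (1 / 2) ^ k := by rw [mul_pow]; ring
          _ ≤ 1 := by simpa using h3
      calc (2 : ℝ) ^ j * (θ * (1 / 2) ^ k * (1 / 2) ^ k) ^ 2
          = (2 ^ j * ((1 / 2) ^ k) ^ 2) * (θ * (1 / 2) ^ k) ^ 2 := by ring
        _ ≤ 1 * (θ * (1 / 2) ^ k) ^ 2 := by gcongr
        _ = _ := one_mul _
    · have : 0 < θ * (1 / 2) ^ k := by positivity
      linarith
  -- Telescoping needs increments only below `m` (small because `j` is `U`-typical) and beyond `j`
  -- (small by domination); none between `m` and `j`. Each sum has mean at most `4 * θ = δ / 2`.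
  refine ⟨j, fun M => ⟨g m - g (j + 1) - ∑ k ∈ Finset.range m, |Δ k| -
    ∑ k ∈ Finset.Ico (j + 1) M, |Δ k|, ?_, fun p i hi k hjk hkM => ?_⟩⟩
  · have h1 : ∑ k ∈ Finset.range m, e j |Δ k| ≤ 2 * θ * 2 :=
      (Finset.sum_le_sum fun k hk => hleft k (Finset.mem_range.1 hk)).trans (by
        rw [← Finset.mul_sum]
        gcongr
        exact sum_half_pow_le _)
    have h2 : ∑ k ∈ Finset.Ico (j + 1) M, e j |Δ k| ≤ 2 * θ * 2 :=
      (Finset.sum_le_sum fun k hk => hright k (Finset.mem_Ico.1 hk).1).trans (by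
        rw [← Finset.mul_sum]
        gcongr
        exact sum_half_pow_le _)
    have h3 := hn j hnj
    rw [map_sub, map_sub, map_sub, map_sum, map_sum]
    linarith
  · have hdist : ∀ a b c d, a ≤ b → Finset.Ico a b ⊆ Finset.Ico c d →
        |g a p - g b p| ≤ ∑ l ∈ Finset.Ico c d, |Δ l p| := fun a b c d hab hs =>
      (dist_le_Ico_sum_dist (fun l => g l p) hab).trans
        (Finset.sum_le_sum_of_subset_of_nonneg hs fun _ _ _ => abs_nonneg _)
    have h1 := hdist i m 0 m hi (Finset.Ico_subset_Ico_left (Nat.zero_le i))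
    have h2 := hdist (j + 1) k (j + 1) M hjk (Finset.Ico_subset_Ico_right hkM)
    have h3 := (abs_le.1 h1).1
    have h4 := (abs_le.1 h2).1
    rw [← Finset.range_eq_Ico] at h1 h3
    have h5 : (g m - g (j + 1) - ∑ l ∈ Finset.range m, |Δ l| -
        ∑ l ∈ Finset.Ico (j + 1) M, |Δ l|) p = g m p - g (j + 1) p -
        ∑ l ∈ Finset.range m, |Δ l p| - ∑ l ∈ Finset.Ico (j + 1) M, |Δ l p| := by
      simp
    rw [h5]
    linarith

end Means

theorem mem_smul_closedBall_one_iff {D : Type*} [NormedAddCommGroup D] [NormedSpace ℝ D] {c : ℝ}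
    (hc : 0 ≤ c) {b : D} : b ∈ c • Metric.closedBall (0 : D) 1 ↔ ‖b‖ ≤ c := by
  rw [smul_unitClosedBall_of_nonneg hc, mem_closedBall_zero_iff]

/-! ### Separation and iterated limits in the bidual. -/

section Bidual

variable {E : Type*} [NormedAddCommGroup E] [NormedSpace ℝ E]

theorem mem_range_add_smul_ball {c : ℝ} (hc : 0 ≤ c) {κ : WeakDual ℝ (StrongDual ℝ E)} (y : E)
    (h : ‖WeakDual.toStrongDual κ - NormedSpace.inclusionInDoubleDual ℝ E y‖ ≤ c) :
    κ ∈ StrongDual.toWeakDual '' (Set.range (NormedSpace.inclusionInDoubleDual ℝ E) +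
      c • Metric.closedBall (0 : StrongDual ℝ (StrongDual ℝ E)) 1) :=
  ⟨WeakDual.toStrongDual κ, ⟨_, ⟨y, rfl⟩, _,
    (mem_smul_closedBall_one_iff (D := StrongDual ℝ (StrongDual ℝ E)) hc).2 h,
    add_sub_cancel _ _⟩, rfl⟩

/-- An element of the bidual at distance more than `ε` from the space is larger than `ε` at a
functional in the unit ball which annihilates a given finite set. -/
theorem exists_annihilator_gt {ξ : StrongDual ℝ (StrongDual ℝ E)} {ε : ℝ} (hε : 0 ≤ ε)
    (hξ : ∀ y, ε < ‖ξ - NormedSpace.inclusionInDoubleDual ℝ E y‖) (s : Finset E) :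
    ∃ f : StrongDual ℝ E, ‖f‖ ≤ 1 ∧ (∀ y ∈ s, f y = 0) ∧ ε < ξ f := by
  by_contra! hcon
  set ι := NormedSpace.inclusionInDoubleDual ℝ E
  set N : Submodule ℝ (StrongDual ℝ E) :=
    ⨅ y : s, LinearMap.ker (ι y : StrongDual ℝ E →ₗ[ℝ] ℝ) with hN
  have hmem : ∀ f, f ∈ N ↔ ∀ y ∈ s, f y = 0 := fun f => by
    simp [hN, Submodule.mem_iInf, ι]
  have hle : ∀ f ∈ N, ‖f‖ ≤ 1 → |ξ f| ≤ ε := fun f hf h1 => by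
    refine abs_le'.2 ⟨hcon f h1 ((hmem f).1 hf), ?_⟩
    have := hcon (-f) (by rwa [norm_neg]) ((hmem _).1 (N.neg_mem hf))
    rwa [map_neg] at this
  -- On the annihilator `N` of `s`, `ξ` has norm at most `ε`. Its Hahn-Banach extension `ζ` differs
  -- from `ξ` by an element of the span of `s`, which puts `ξ` within `ε` of the space.
  obtain ⟨ζ, hζ, hζn⟩ := exists_extension_norm_eq N (ξ.comp N.subtypeL)
  have hζε : ‖ζ‖ ≤ ε := by
    rw [hζn]
    exact ContinuousLinearMap.opNorm_le_of_unit_norm hε fun f hf => hle f f.2 (le_of_eq hf)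
  have hspan : ((ξ - ζ : StrongDual ℝ (StrongDual ℝ E)) : StrongDual ℝ E →ₗ[ℝ] ℝ) ∈
      Submodule.span ℝ (Set.range fun y : s => (ι y : StrongDual ℝ E →ₗ[ℝ] ℝ)) := by
    refine mem_span_of_iInf_ker_le_ker fun f hf => ?_
    have := hζ ⟨f, hf⟩
    simp only [ContinuousLinearMap.comp_apply, Submodule.subtypeL_apply] at this
    simp [this]
  have hrange : ∃ y, ((ξ - ζ : StrongDual ℝ (StrongDual ℝ E)) : StrongDual ℝ E →ₗ[ℝ] ℝ) = ι y := by
    refine Submodule.span_induction ?_ ?_ ?_ ?_ hspan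
    · rintro _ ⟨y, rfl⟩
      exact ⟨y, rfl⟩
    · exact ⟨0, by simp⟩
    · rintro _ _ - - ⟨y, rfl⟩ ⟨z, rfl⟩
      exact ⟨y + z, by simp⟩
    · rintro a _ - ⟨y, rfl⟩
      exact ⟨a • y, by simp⟩
  obtain ⟨y, hy⟩ := hrange
  have hy' : ξ - ζ = ι y := ContinuousLinearMap.coe_injective hy
  have := hξ y
  rw [← hy', show ξ - (ξ - ζ) = ζ from sub_sub_cancel ξ ζ] at this
  linarith

/-- James-type sequences for an element of the weak-star closure of `B` which is far from the
space. -/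
theorem exists_seq_separated {B : Set E} {ξ : WeakDual ℝ (StrongDual ℝ E)}
    (hξB : ξ ∈ closure ((fun x =>
      StrongDual.toWeakDual (NormedSpace.inclusionInDoubleDual ℝ E x)) '' B)) {ε : ℝ} (hε : 0 ≤ ε)
    (hξ : ∀ y, ε < ‖WeakDual.toStrongDual ξ - NormedSpace.inclusionInDoubleDual ℝ E y‖) :
    ∃ (f : ℕ → StrongDual ℝ E) (x : ℕ → E), (∀ i, ‖f i‖ ≤ 1) ∧ (∀ j, x j ∈ B) ∧
      (∀ i j, i ≤ j → ε < f i (x j)) ∧ ∀ i j, j < i → f i (x j) = 0 := by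
  classical
  -- Each new functional kills the earlier points and keeps `ξ` above `ε`; each new point of `B`
  -- imitates `ξ` on all functionals so far.
  obtain ⟨z, hz, hzr⟩ := exists_seq_of_forall_finset_exists
    (fun p : StrongDual ℝ E × E => ‖p.1‖ ≤ 1 ∧ ε < ξ p.1 ∧ p.2 ∈ B ∧ ε < p.1 p.2)
    (fun p q => q.1 p.2 = 0 ∧ ε < p.1 q.2) (by
      intro s hs
      obtain ⟨f, hf, hfs, hfξ⟩ := exists_annihilator_gt hε hξ (s.image Prod.snd)
      have hopen : IsOpen {κ : WeakDual ℝ (StrongDual ℝ E) |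
          ∀ g ∈ insert f (s.image Prod.fst), ε < κ g} := by
        simp only [Set.ofPred_forall]
        exact isOpen_biInter_finset fun g _ =>
          isOpen_lt continuous_const (WeakDual.eval_continuous g)
      obtain ⟨_, hκ, y, hy, rfl⟩ := mem_closure_iff.1 hξB _ hopen (by
        intro g hg
        rcases Finset.mem_insert.1 hg with rfl | hg
        · exact hfξ
        · obtain ⟨p, hp, rfl⟩ := Finset.mem_image.1 hg
          exact (hs p hp).2.1)
      refine ⟨(f, y), ⟨hf, hfξ, hy, hκ f (Finset.mem_insert_self _ _)⟩, fun p hp => ⟨?_, ?_⟩⟩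
      · exact hfs _ (Finset.mem_image_of_mem _ hp)
      · exact hκ p.1 (Finset.mem_insert_of_mem (Finset.mem_image_of_mem _ hp)))
  refine ⟨fun i => (z i).1, fun j => (z j).2, fun i => (hz i).1, fun j => (hz j).2.2.1,
    fun i j hij => ?_, fun i j hji => (hzr j i hji).1⟩
  rcases hij.eq_or_lt with rfl | hij
  · exact (hz i).2.2.2
  · exact (hzr i j hij).2

theorem norm_sub_inclusion_zero (κ : WeakDual ℝ (StrongDual ℝ E)) {R : ℝ}
    (h : κ ∈ WeakDual.toStrongDual ⁻¹' Metric.closedBall (0 : StrongDual ℝ (StrongDual ℝ E)) R) :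
    ‖WeakDual.toStrongDual κ - NormedSpace.inclusionInDoubleDual ℝ E 0‖ ≤ R := by
  rw [map_zero]
  exact (mem_closedBall_iff_norm (E := StrongDual ℝ (StrongDual ℝ E))).1 h

/-- Bidual balls are weak-star closed. This yields both the compactness behind the limits and an
admissible radius for a bounded set. -/
theorem closure_image_subset_ball {B : Set E} {R : ℝ} (hB : ∀ y ∈ B, ‖y‖ ≤ R) :
    closure ((fun x => StrongDual.toWeakDual (NormedSpace.inclusionInDoubleDual ℝ E x)) '' B) ⊆
      WeakDual.toStrongDual ⁻¹' Metric.closedBall (0 : StrongDual ℝ (StrongDual ℝ E)) R := by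
  refine closure_minimal ?_ (WeakDual.isClosed_closedBall 0 R)
  rintro _ ⟨y, hy, rfl⟩
  exact (mem_closedBall_zero_iff (E := StrongDual ℝ (StrongDual ℝ E))).2
    ((NormedSpace.double_dual_bound ℝ E y).trans (hB y hy))

/-- Sequences in a weak-star compact set of functionals have pointwise limits in the set along
ultrafilters. -/
theorem exists_mem_tendsto_ultrafilter {F : Type*} [NormedAddCommGroup F] [NormedSpace ℝ F]
    {ι : Type*} (U : Ultrafilter ι) {K : Set (WeakDual ℝ F)} (hK : IsCompact K)
    (κ : ι → WeakDual ℝ F) (hκ : ∀ n, κ n ∈ K) :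
    ∃ κ' ∈ K, ∀ f, Tendsto (fun n => κ n f) (U : Filter ι) (𝓝 (κ' f)) := by
  obtain ⟨κ', hκ', hle⟩ := hK.ultrafilter_le_nhds (U.map κ) (by
    rw [le_principal_iff]
    exact Filter.mem_map.2 (Filter.univ_mem' hκ))
  exact ⟨κ', hκ', fun f => (WeakDual.eval_continuous f).continuousAt.tendsto.comp hle⟩

/-- If the weak-star closure of `B` is within `c` of the space, then `B` admits no separated
systems with a constant larger than `4 * c`. -/
theorem le_four_mul_of_separated (U : Ultrafilter ℕ) (hU : (U : Filter ℕ) ≤ cofinite)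
    {B : Set E} {R : ℝ} (hB : ∀ y ∈ B, ‖y‖ ≤ R) {c : ℝ}
    (hc : closure ((fun x =>
        StrongDual.toWeakDual (NormedSpace.inclusionInDoubleDual ℝ E x)) '' B) ⊆
      StrongDual.toWeakDual '' (Set.range (NormedSpace.inclusionInDoubleDual ℝ E) +
        c • Metric.closedBall (0 : StrongDual ℝ (StrongDual ℝ E)) 1))
    (hc0 : 0 ≤ c) {G : ℕ → StrongDual ℝ E} (hG : ∀ k, ‖G k‖ ≤ 1) {ε : ℝ}
    (h : ∀ m, ∃ j, ∀ M, ∃ y ∈ B, ∀ i ≤ m, ∀ k, j < k → k ≤ M → ε ≤ G i y - G k y) :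
    ε ≤ 4 * c := by
  set K := closure ((fun x =>
    StrongDual.toWeakDual (NormedSpace.inclusionInDoubleDual ℝ E x)) '' B) with hKdef
  have hK : IsCompact K := (WeakDual.isCompact_closedBall 0 R).of_isClosed_subset isClosed_closure
    (closure_image_subset_ball hB)
  have hlarge : ∀ n, ∀ᶠ k in (U : Filter ℕ), n ≤ k := fun n =>
    (hU.trans Nat.cofinite_eq_atTop.le) (eventually_ge_atTop n)
  obtain ⟨H', hH', hGH⟩ := exists_mem_tendsto_ultrafilter U
    (WeakDual.isCompact_closedBall (0 : StrongDual ℝ E) 1)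
    (fun k => StrongDual.toWeakDual (G k)) (fun k => mem_closedBall_zero_iff.2 (hG k))
  set H : StrongDual ℝ E := WeakDual.toStrongDual H'
  have hH : ‖H‖ ≤ 1 := mem_closedBall_zero_iff.1 hH'
  have hGH' : ∀ y, Tendsto (fun k => G k y) (U : Filter ℕ) (𝓝 (H y)) := hGH
  -- Write `κ = y + c b`: the part from `y` converges, and `‖G k - H‖ ≤ 2` bounds the rest by `2 *
  -- c`.
  have hnear : ∀ κ ∈ K, ∀ δ > 0, ∀ᶠ k in (U : Filter ℕ), |κ (G k) - κ H| < 2 * c + δ := by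
    intro κ hκ δ hδ
    obtain ⟨_, ⟨_, ⟨y, rfl⟩, _, ⟨b, hb, rfl⟩, rfl⟩, rfl⟩ := hc hκ
    have hb1 : ‖b‖ ≤ 1 :=
      (mem_closedBall_zero_iff (E := StrongDual ℝ (StrongDual ℝ E))).1 hb
    filter_upwards [(Metric.tendsto_nhds.1 (hGH' y)) δ hδ] with k hk
    have h1 : |b (G k - H)| ≤ 2 := by
      refine (b.le_of_opNorm_le hb1 _).trans ?_
      rw [one_mul]
      exact (norm_sub_le _ _).trans (by linarith [hG k])
    have h2 : (G k y + c * b (G k)) - (H y + c * b H) = (G k y - H y) + c * b (G k - H) := by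
      rw [map_sub]; ring
    change |(G k y + c * b (G k)) - (H y + c * b H)| < 2 * c + δ
    rw [h2]
    rw [Real.dist_eq] at hk
    have h3 : |c * b (G k - H)| ≤ c * 2 := by
      rw [abs_mul, abs_of_nonneg hc0]
      gcongr
    linarith [abs_add_le (G k y - H y) (c * b (G k - H))]
  refine le_of_forall_pos_le_add fun δ hδ => ?_
  have hκ : ∀ m, ∃ κ ∈ K, ∀ i ≤ m, ε - (2 * c + δ / 2) ≤ κ (G i) - κ H := by
    intro m
    obtain ⟨j, hj⟩ := h m
    choose y hyB hy using hj
    obtain ⟨κ, hκ, hlim⟩ := exists_mem_tendsto_ultrafilter U hK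
      (fun M => StrongDual.toWeakDual (NormedSpace.inclusionInDoubleDual ℝ E (y M)))
      (fun M => subset_closure ⟨y M, hyB M, rfl⟩)
    refine ⟨κ, hκ, fun i hi => ?_⟩
    obtain ⟨k, hk, hjk⟩ := ((hnear κ hκ (δ / 2) (half_pos hδ)).and (hlarge (j + 1))).exists
    have h1 : ε ≤ κ (G i) - κ (G k) := by
      refine ge_of_tendsto ((hlim (G i)).sub (hlim (G k))) ?_
      filter_upwards [hlarge k] with M hM
      exact hy M i hi k hjk hM
    linarith [(abs_lt.1 hk).1, (abs_lt.1 hk).2]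
  choose κ hκK hκ using hκ
  -- Replacing `G k` by `H` has cost one `2 * c`; letting `m` and then `i` grow costs the second.
  obtain ⟨κ', hκ'K, hlim⟩ := exists_mem_tendsto_ultrafilter U hK κ hκK
  obtain ⟨i, hi⟩ := (hnear κ' hκ'K (δ / 2) (half_pos hδ)).exists
  have h1 : ε - (2 * c + δ / 2) ≤ κ' (G i) - κ' H := by
    refine ge_of_tendsto ((hlim (G i)).sub (hlim H)) ?_
    filter_upwards [hlarge i] with m hm
    exact hκ m i hm
  linarith [(abs_lt.1 hi).2]

end Bidual

/-! ### Transfer from `conv(A)^U` to `A^U`. -/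

section Ultrapower

variable {X : Type*} [NormedAddCommGroup X] [NormedSpace ℝ X]

/-- Evaluation of a bounded sequence of functionals on the points of a bounded set `A`. -/
def evalSeq {A : Set X} {R : ℝ} (hR : ∀ a ∈ A, ‖a‖ ≤ R) :
    lp (fun _ : ℕ => StrongDual ℝ X) ∞ →ₗ[ℝ] (ℕ × A) →ᵇ ℝ where
  toFun F := BoundedContinuousFunction.ofNormedAddCommGroup (fun p => F p.1 p.2)
    (continuous_prod_of_discrete_left.2 fun n => (F n).continuous.comp continuous_subtype_val)
    (‖F‖ * R) fun p => ((F p.1).le_opNorm p.2).trans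
      (mul_le_mul (lp.norm_apply_le_norm ENNReal.top_ne_zero F p.1) (hR _ p.2.2) (norm_nonneg _)
        (norm_nonneg _))
  map_add' F G := by ext p; simp
  map_smul' c F := by ext p; simp

/-- Separated sequences for `conv(A)^U` give separated systems in `A^U`. -/
theorem exists_separated_of_convexHull (U : Ultrafilter ℕ) (hU : (U : Filter ℕ) ≤ cofinite)
    {A : Set X} {R : ℝ} (hR : ∀ a ∈ A, ‖a‖ ≤ R)
    {x : ℕ → lp (fun _ : ℕ => X) ∞} (hx : ∀ j n, x j n ∈ convexHull ℝ A)
    {f : ℕ → StrongDual ℝ (BanachUltrapower X U)} (hf : ∀ i, ‖f i‖ ≤ 1) {ε δ : ℝ}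
    (hle : ∀ i j, i ≤ j → ε ≤ f i ((ultraNull X U).mkQ (x j)))
    (hlt : ∀ i j, j < i → f i ((ultraNull X U).mkQ (x j)) ≤ 0) (hδ : 0 < δ) :
    ∃ G : ℕ → StrongDual ℝ (BanachUltrapower X U), (∀ k, ‖G k‖ ≤ 1) ∧
      ∀ m, ∃ j, ∀ M, ∃ y ∈ ultrapowerSet U A, ∀ i ≤ m, ∀ k, j < k → k ≤ M →
        ε - δ ≤ G i y - G k y := by
  obtain ⟨a₀, ha₀⟩ := convexHull_nonempty_iff.1 ⟨_, hx 0 0⟩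
  have hR0 : 0 ≤ R := (norm_nonneg _).trans (hR _ ha₀)
  choose F hF hFx using fun i => exists_seq_tendsto_countable U hU (f i) (hf i) x
  choose μ hμ hμ1 hμx using fun j n => exists_mean_of_mem_convexHull (hx j n)
  let ν : ℕ → ℕ → ((ℕ × A) →ᵇ ℝ) →ₗ[ℝ] ℝ := fun j n =>
    { toFun := fun w => μ j n fun a => w (n, a)
      map_add' := fun v w => map_add (μ j n) (fun a => v (n, a)) fun a => w (n, a)
      map_smul' := fun c w => map_smul (μ j n) c fun a => w (n, a) }
  have hν : ∀ j n w, ν j n w = μ j n fun a => w (n, a) := fun _ _ _ => rfl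
  have hν0 : ∀ j n w, 0 ≤ w → 0 ≤ ν j n w := fun j n w hw => hμ j n _ fun a => hw (n, a)
  have hν1 : ∀ j n, ν j n 1 = 1 := fun j n => hμ1 j n
  choose e he using fun j => exists_linearMap_tendsto_ultrafilter U (ν j) fun w =>
    ⟨‖w‖, fun n => abs_le_norm_of_mean (hν0 j n) (hν1 j n) w⟩
  have he0 : ∀ j w, 0 ≤ w → 0 ≤ e j w := fun j w hw =>
    ge_of_tendsto' (he j w) fun n => hν0 j n w hw
  have he1 : ∀ j, e j 1 = 1 := fun j =>
    tendsto_nhds_unique (he j 1) (by simp only [hν1]; exact tendsto_const_nhds)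
  set Φ : ℕ → lp (fun _ : ℕ => StrongDual ℝ X) ∞ := fun i => lpOfBounded (F i) (hF i) with hΦ
  have hΦ1 : ∀ i, ‖Φ i‖ ≤ 1 := fun i => lp.norm_le_of_forall_le zero_le_one (hF i)
  have heΦ : ∀ i j, e j (evalSeq hR (Φ i)) = f i ((ultraNull X U).mkQ (x j)) := fun i j =>
    tendsto_nhds_unique (he j _) ((hFx i j).congr fun n => (hμx j n (F i n)).symm)
  obtain ⟨g, hg, hsep⟩ := exists_convex_blocks U hU he0 he1 (h := fun i => evalSeq hR (Φ i))
    (R := R) (fun i => by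
      refine (BoundedContinuousFunction.norm_le hR0).2 fun p => ?_
      exact ((F i p.1).le_of_opNorm_le (hF i p.1) p.2).trans ((one_mul _).trans_le (hR _ p.2.2)))
    (fun i j hij => (hle i j hij).trans (heΦ i j).ge)
    (fun i j hij => (heΦ i j).le.trans (hlt i j hij)) (half_pos hδ)
  -- By linearity of `evalSeq`, each block is again the evaluation of a sequence in the dual ball,
  -- so it induces a functional on the ultrapower.
  have hpull : ∀ k, ∃ Ψ : lp (fun _ : ℕ => StrongDual ℝ X) ∞, ‖Ψ‖ ≤ 1 ∧ evalSeq hR Ψ = g k := by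
    intro k
    have h1 := hg k
    rw [Set.range_comp' (evalSeq hR) Φ, ← LinearMap.image_convexHull] at h1
    obtain ⟨Ψ, hΨ, hΨg⟩ := h1
    refine ⟨Ψ, mem_closedBall_zero_iff.1 (convexHull_min ?_ (convex_closedBall _ _) hΨ), hΨg⟩
    rintro _ ⟨i, rfl⟩
    exact mem_closedBall_zero_iff.2 (hΦ1 i)
  choose Ψ hΨ hΨg using hpull
  choose G hG hGΨ using fun k => exists_ultrapower_functional U (fun n => Ψ k n)
    fun n => (lp.norm_apply_le_norm ENNReal.top_ne_zero (Ψ k) n).trans (hΨ k)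
  refine ⟨G, hG, fun m => ?_⟩
  obtain ⟨j, hj⟩ := hsep m
  refine ⟨j, fun M => ?_⟩
  obtain ⟨ψ, hψ, hψg⟩ := hj M
  -- A mean cannot exceed every value of a function. The implication lets `a` be chosen for all `n`,
  -- including those outside the relevant set of `U`.
  have hpoint : ∀ n, ∃ a : A, ε - δ < ν j n ψ → ε - δ ≤ ψ (n, a) := by
    intro n
    by_contra! hcon
    have h1 : ν j n ψ ≤ ε - δ := by
      have h2 := hμ j n ((ε - δ) • 1 - fun a => ψ (n, a)) fun a => by
        simpa using (hcon a).2.le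
      rw [map_sub, map_smul, hμ1, smul_eq_mul, mul_one] at h2
      rw [hν]
      linarith
    exact absurd h1 (not_le.2 (hcon ⟨a₀, ha₀⟩).1)
  choose a ha using hpoint
  set y : lp (fun _ : ℕ => X) ∞ := lpOfBounded (fun n => (a n : X)) fun n => hR _ (a n).2 with hy
  refine ⟨(ultraNull X U).mkQ y, ⟨y, fun n => (a n).2, rfl⟩, fun i hi k hjk hkM => ?_⟩
  refine ge_of_tendsto ((hGΨ i y).sub (hGΨ k y)) ?_
  -- The blocks were built with `δ / 2`, which leaves the strict inequality needed here.
  filter_upwards [(he j ψ).eventually (lt_mem_nhds (show ε - δ < e j ψ by linarith))] with n hn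
  have h1 := hψg (n, a n) i hi k hjk hkM
  rw [← hΨg, ← hΨg] at h1
  exact (ha n hn).trans h1

theorem norm_le_of_mem_ultrapowerSet (U : Ultrafilter ℕ) {A : Set X} {R : ℝ}
    (hR : ∀ a ∈ A, ‖a‖ ≤ R) {y : BanachUltrapower X U} (hy : y ∈ ultrapowerSet U A) : ‖y‖ ≤ R := by
  obtain ⟨x, hx, rfl⟩ := hy
  exact (Submodule.Quotient.norm_mk_le _ _).trans (lp.norm_le_of_forall_le
    ((norm_nonneg _).trans (hR _ (hx 0))) fun n => hR _ (hx n))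

end Ultrapower

end

theorem theorem6p7 {X : Type*} [NormedAddCommGroup X] [NormedSpace ℝ X] [CompleteSpace X]
    (A : Set X) (hA : Bornology.IsBounded A)
    (U : Ultrafilter ℕ) (hU : (U : Filter ℕ) ≤ Filter.cofinite) :
    weakNoncompactness (ultrapowerSet U (convexHull ℝ A)) ≤
      4 * weakNoncompactness (ultrapowerSet U A) := by
  obtain ⟨R, hR⟩ := hA.exists_norm_le
  have hB : ∀ y ∈ ultrapowerSet U A, ‖y‖ ≤ R := fun y hy => norm_le_of_mem_ultrapowerSet U hR hy
  rw [mul_comm, ← div_le_iff₀ (by norm_num)]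
  -- The infimum needs a nonempty set: `max R 1` is admissible, with `0` as the approximating point.
  refine le_csInf ⟨max R 1, lt_max_of_lt_right one_pos, fun κ hκ => ?_⟩ fun c ⟨hc0, hc⟩ => ?_
  · have h1 := closure_image_subset_ball hB hκ
    exact mem_range_add_smul_ball (le_max_of_le_right zero_le_one) 0
      ((norm_sub_inclusion_zero κ h1).trans (le_max_left _ _))
  rw [div_le_iff₀ (by norm_num), mul_comm]
  refine le_of_forall_gt_imp_ge_of_dense fun ε hε => ?_
  have hε0 : 0 < ε := by linarith
  refine csInf_le ⟨0, fun _ h => h.1.le⟩ ⟨hε0, fun ξ hξ => ?_⟩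
  by_contra hcon
  have hfar : ∀ y, ε < ‖WeakDual.toStrongDual ξ -
      NormedSpace.inclusionInDoubleDual ℝ (BanachUltrapower X U) y‖ := by
    intro y
    by_contra! hy
    exact hcon (mem_range_add_smul_ball hε0.le y hy)
  obtain ⟨f, z, hf, hz, hle, hlt⟩ := exists_seq_separated hξ hε0.le hfar
  choose x hx hxz using hz
  obtain rfl : (fun j => (ultraNull X U).mkQ (x j)) = z := funext hxz
  obtain ⟨G, hG, hsep⟩ := exists_separated_of_convexHull U hU hR hx hf
    (fun i j hij => (hle i j hij).le) (fun i j hij => (hlt i j hij).le)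
    (show 0 < (ε - 4 * c) / 2 by linarith)
  have := le_four_mul_of_separated U hU hB hc hc0.le hG hsep
  linarith
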